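/- Let $N$ be a finite set of players. A weight system $(\omega,\Sigma)$ consists of weights $\omega_i>0$ $(i\in N)$ and an ordered partition $\Sigma=(N^{(1)},\dots,N^{(\overline k)})$ of $N$ into nonempty classes; the priority of $i\in N$ is the integer $p(i)$ with $i\in N^{(p(i))}$. For a nonempty $T\subseteq N$ put $p(T)=\max_{i\in T}p(i)$, and $\overline{\omega}^T_i=\omega_i$ if $i\in T$ and $p(i)=p(T)$, $\overline{\omega}^T_i=0$ otherwise. A game is a function $v:2^N\to\mathbb{R}$ with $v(\emptyset)=0$; it is $(\omega,\Sigma)$-convex if for all $S\subseteq T\subseteq N$ \[ \sum_{i\in S}\overline{\omega}^T_i\bigl(v(T)-v(T\setminus\{i\})-v(S)+v(S\setminus\{i\})\bigr)\ge 0 . \] For a graph $G=(N,E)$ the communication game is $v^G(S)=\sum_{A} v(A)$, the sum being over the connected components $A$ of the subgraph of $G$ induced by $S$. The graph $G$ preserves $(\omega,\Sigma)$-convexity if $v^G$ is $(\omega,\Sigma)$-convex for every $(\omega,\Sigma)$-convex game $v$. The graph $G$ is an $(\omega,\Sigma)$-priority-decreasing tree if it is a tree and there is a root $r\in N$ such that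 $p(j)\le p(i)$ whenever $i$ lies on the path from $r$ to $j$. A star with center $c$ is a graph on a finite vertex set containing $c$ whose edges are exactly the pairs $\{c,x\}$ with $x\ne c$ (a single vertex is a star). **Theorem.** Let $(\omega,\Sigma)$ be a weight system with priorities $1,\dots,\overline k$ (from low to high) and let $G=(N,E)$ be an $(\omega,\Sigma)$-priority-decreasing tree. The following are equivalent: 1. $G$ preserves $(\omega,\Sigma)$-convexity. 2. There exist $m\ge 1$ and integers $k_1>k_2>\dots>k_m>k_{m+1}=0$ and nodes $c_1,\dots,c_m\in N$ such that, with $N_l=\{i\in N: k_{l+1}+1\le p(i)\le k_l\}$ for $1\le l\le m$: (a) $k_1=\overline k$; (b) for every $1\le l\le m$, the subgraph of $G$ induced by $N_l$ is a star with center $c_l$; (c) for every $1\le l\le m$, $p(c_l)=k_l$; (d) for every $1\le l\le m-1$, there is exactly one edge of $G$ between $N_l$ and $N_{l+1}$, and this edge joins $c_l$ to a node of $N_{l+1}$ of priority $k_{l+1}$. -/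

import Mathlib

open Finset

/-- A weight system `(ω, Σ)` on the player set `N`: positive weights `ω`, and an ordered partition
`Σ = (N_1, …, N_k)` of `N` into nonempty classes. The ordered partition is recorded by its priority
map `p`, so that `N_j` is the fibre of `p` over `j`; the classes are nonempty, cover `N` and are
numbered `1, …, k` exactly when the range of `p` is `{1, …, k}`. -/
structure WeightSystem (N : Type*) where
  weight : N → ℝ
  weight_pos : ∀ i, 0 < weight i
  numLevels : ℕ
  priority : N → ℕ
  range_priority : Set.range priority = Set.Icc 1 numLevels

/-- A TU-game on the player set `N`: a characteristic function vanishing on the empty coalition. -/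
structure TUGame (N : Type*) where
  value : Finset N → ℝ
  value_empty : value ∅ = 0

namespace WeightSystem

variable {N : Type*} (W : WeightSystem N)

/-- The priority `p(S)` of a coalition: the largest priority of a member (only used for nonempty
coalitions). -/
def coalitionPriority (S : Finset N) : ℕ := S.sup W.priority

/-- The members of `S` with the highest priority. -/
def top (S : Finset N) : Finset N := S.filter fun i => W.priority i = W.coalitionPriority S

open Classical in
/-- The relative weight of `i` in the coalition `T`: its weight if `i` has the highest priority
in `T`, and `0` otherwise. -/
noncomputable def relWeight (T : Finset N) (i : N) : ℝ := if i ∈ W.top T then W.weight i else 0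

/-- The set of players with priority strictly above `a` and at most `b`. -/
def band [Fintype N] (a b : ℕ) : Finset N :=
  univ.filter fun i => a < W.priority i ∧ W.priority i ≤ b

/-- `(ω, Σ)`-convexity of a game. -/
def IsConvexGame [DecidableEq N] (v : TUGame N) : Prop :=
  ∀ S T : Finset N, S ⊆ T →
    0 ≤ ∑ i ∈ S, W.relWeight T i *
      (v.value T - v.value (T.erase i) - v.value S + v.value (S.erase i))

end WeightSystem

section Graph

variable {N : Type*}

/-- `A` is the vertex set of a connected component of the subgraph of `G` induced by `S`. -/
def IsComponentIn (G : SimpleGraph N) (S A : Finset N) : Prop :=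
  ∃ C : (G.induce (S : Set N)).ConnectedComponent, (A : Set N) = Subtype.val '' C.supp

open Classical in
/-- The vertex sets of the connected components of the subgraph of `G` induced by `S`. -/
noncomputable def componentsIn (G : SimpleGraph N) (S : Finset N) : Finset (Finset N) :=
  S.powerset.filter fun A => IsComponentIn G S A

theorem mem_componentsIn (G : SimpleGraph N) (S A : Finset N) :
    A ∈ componentsIn G S ↔ A ⊆ S ∧ IsComponentIn G S A := by
  simp [componentsIn]

theorem componentsIn_empty (G : SimpleGraph N) : componentsIn G ∅ = ∅ := by
  refine Finset.eq_empty_of_forall_notMem fun A hA => ?_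
  obtain ⟨C, -⟩ := ((mem_componentsIn G ∅ A).mp hA).2
  obtain ⟨x, -⟩ := C.nonempty_supp
  exact absurd x.2 (by simp)

/-- The communication game `v^G`: the worth of `S` is the sum of the worths of the connected
components of the subgraph induced by `S`. -/
noncomputable def communicationGame (G : SimpleGraph N) (v : TUGame N) : TUGame N where
  value S := ∑ A ∈ componentsIn G S, v.value A
  value_empty := by simp [componentsIn_empty]

/-- `G` preserves `(ω, Σ)`-convexity. -/
def PreservesConvexity [DecidableEq N] (G : SimpleGraph N) (W : WeightSystem N) : Prop :=
  ∀ v : TUGame N, W.IsConvexGame v → W.IsConvexGame (communicationGame G v)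

/-- `G` is a tree having a root `r` such that priorities are (weakly) decreasing for the tree order
generated from `r`: `i` precedes `j` when `i` lies on the path from `r` to `j`. -/
def IsPriorityDecreasingTree (G : SimpleGraph N) (W : WeightSystem N) : Prop :=
  G.IsTree ∧ ∃ r : N, ∀ (i j : N) (P : G.Walk r j), P.IsPath → i ∈ P.support →
    W.priority j ≤ W.priority i

/-- The subgraph of `G` induced by `A` is a star with center `c`. -/
def IsStarOn (G : SimpleGraph N) (A : Finset N) (c : N) : Prop :=
  ∃ hc : c ∈ (A : Set N), G.induce (A : Set N) = SimpleGraph.starGraph ⟨c, hc⟩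

end Graph

/-! Sufficiency. The marginal worth of `i` in `v^G` depends only on the component containing `i`, so
it is enough to test connected `A ⊆ B`. Let the top priority of `B` lie in the band of a star with
center `c`, and let `L` be the set of players of all lower bands. In `B`, every player outside `L`
other than `c` is adjacent at most to `c`. Removing such a leaf keeps a coalition containing `c`
connected, so `v^G` agrees with `v` there. Removing `c` leaves isolated players and the connected
remainder in `L`, and the resulting loss `v - v^G` is an excess that grows with the coalition
(`IsConvexGame.excess_mono`). Hence the inequality for `v^G` dominates the one for `v`, term by
term. If `c ∉ A`, then `A` is a single player, and superadditivity suffices.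

Necessity. Preservation forbids paths `a, i, j, b` with `p a, p b ≤ p i ≤ p j`
(`noDominatedPath_of_preservesConvexity`). The game used rewards `a` and `i` together by `1`, but
only by `δ < 1` when `b` is present. In `v` the player `j` is irrelevant to the bonus; in `v^G` the
removal of `j` separates `b` from `a, i` and raises the bonus from `δ` to `1`, which penalises `j`.

In a priority-decreasing tree priorities along a path never fall below both end values. Together
with the forbidden path this gives, at the highest remaining priority `k`, a center `c` with at most
one neighbour `y` through which the remaining tree continues. The players of priority above `p y`
form a star around `c`, those of priority at most `p y` form a subtree attached by the edge `c y`,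
and induction on `k` builds the chain. -/

section Linked

/-! ### Connectedness inside a coalition and the communication game -/

variable {N : Type*} {G : SimpleGraph N} {A B S : Finset N} {x y z : N}

/-- `y` can be reached from `x` along edges of `G` all of whose endpoints, except possibly `x`,
lie in `A`. -/
def LinkedIn (G : SimpleGraph N) (A : Finset N) : N → N → Prop :=
  Relation.ReflTransGen fun x y => G.Adj x y ∧ y ∈ A

/-- `A` is nonempty and induces a connected subgraph. -/
def ConnectedOn (G : SimpleGraph N) (A : Finset N) : Prop :=
  A.Nonempty ∧ ∀ x ∈ A, ∀ y ∈ A, LinkedIn G A x y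

theorem LinkedIn.mono (h : LinkedIn G A x y) (hAB : A ⊆ B) : LinkedIn G B x y :=
  Relation.ReflTransGen.mono (fun _ _ h => ⟨h.1, hAB h.2⟩) _ _ h

theorem LinkedIn.symm (h : LinkedIn G A x y) (hx : x ∈ A) : LinkedIn G A y x := by
  suffices y ∈ A ∧ LinkedIn G A y x from this.2
  induction h with
  | refl => exact ⟨hx, .refl⟩
  | tail _ h2 ih => exact ⟨h2.2, .head ⟨h2.1.symm, ih.1⟩ ih.2⟩

theorem LinkedIn.mem_of_closed (h : LinkedIn G A x y) (hx : x ∈ B)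
    (hB : ∀ u ∈ B, ∀ w ∈ A, G.Adj u w → w ∈ B) : y ∈ B := by
  induction h with
  | refl => exact hx
  | tail _ h2 ih => exact hB _ ih _ h2.2 h2.1

theorem ConnectedOn.of_center (hx : x ∈ A) (h : ∀ y ∈ A, LinkedIn G A x y) : ConnectedOn G A :=
  ⟨⟨x, hx⟩, fun y hy z hz => ((h y hy).symm hx).trans (h z hz)⟩

theorem ConnectedOn.subset_of_closed (hA : ConnectedOn G A) (hx : x ∈ A) (hxB : x ∈ B)
    (hB : ∀ u ∈ B, ∀ w ∈ A, G.Adj u w → w ∈ B) : A ⊆ B :=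
  fun y hy => (hA.2 x hx y hy).mem_of_closed hxB hB

theorem ConnectedOn.eq_singleton (hA : ConnectedOn G A) (hx : x ∈ A)
    (h : ∀ w ∈ A, ¬ G.Adj x w) : A = {x} := by
  refine Subset.antisymm (hA.subset_of_closed hx (mem_singleton_self x) fun u hu w hw huw => ?_)
    (singleton_subset_iff.mpr hx)
  rw [mem_singleton.mp hu] at huw
  exact absurd huw (h w hw)

theorem connectedOn_singleton : ConnectedOn G {x} :=
  .of_center (mem_singleton_self x) fun y hy => by rw [mem_singleton.mp hy]; exact .refl

/-- A part of the subgraph induced by `S` from which no edge leads to the rest of `S`. -/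
theorem exists_component (hx : x ∈ S) : ∃ A ⊆ S, x ∈ A ∧ ConnectedOn G A ∧
    ∀ u ∈ A, ∀ w ∈ S, G.Adj u w → w ∈ A := by
  classical
  refine ⟨S.filter fun y => LinkedIn G S x y, filter_subset _ _, ?_, .of_center (x := x) ?_ ?_, ?_⟩
  · exact mem_filter.mpr ⟨hx, .refl⟩
  · exact mem_filter.mpr ⟨hx, .refl⟩
  · intro y hy
    replace hy := (mem_filter.mp hy).2
    induction hy with
    | refl => exact .refl
    | tail h1 h2 ih =>
      exact .tail ih ⟨h2.1, mem_filter.mpr ⟨h2.2, h1.tail h2⟩⟩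
  · intro u hu w hw h
    exact mem_filter.mpr ⟨hw, (mem_filter.mp hu).2.tail ⟨h, hw⟩⟩

/-- Replaces connected components of an induced subtype graph by connected sets of vertices closed
under adjacency in `S`, the form used everywhere below. -/
theorem mem_componentsIn_iff : A ∈ componentsIn G S ↔
    A ⊆ S ∧ ConnectedOn G A ∧ ∀ u ∈ A, ∀ w ∈ S, G.Adj u w → w ∈ A := by
  rw [mem_componentsIn]
  refine and_congr_right fun hAS => ⟨?_, ?_⟩
  · rintro ⟨C, hC⟩
    have hmem : ∀ y, y ∈ A ↔ ∃ h : y ∈ (S : Set N), (⟨y, h⟩ : (S : Set N)) ∈ C.supp := by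
      intro y
      rw [← mem_coe, hC]
      simp
    have hstep : ∀ u ∈ A, ∀ w ∈ S, G.Adj u w → w ∈ A := by
      intro u hu w hw h
      obtain ⟨hu', hu''⟩ := (hmem u).mp hu
      refine (hmem w).mpr ⟨hw, ?_⟩
      exact C.mem_supp_of_adj_mem_supp hu'' (by simpa using h)
    have hwalk : ∀ (u v : (S : Set N)) (_ : (G.induce (S : Set N)).Walk u v), u.1 ∈ A →
        LinkedIn G A u.1 v.1 := by
      intro u v w
      induction w with
      | nil => intro _; exact .refl
      | @cons a b c h p ih =>
        intro hu
        have hadj : G.Adj a.1 b.1 := by simpa using h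
        have hv := hstep _ hu _ b.2 hadj
        exact .head ⟨hadj, hv⟩ (ih hv)
    refine ⟨⟨?_, ?_⟩, hstep⟩
    · obtain ⟨x, hx⟩ := C.nonempty_supp
      exact ⟨x.1, (hmem _).mpr ⟨x.2, hx⟩⟩
    · intro x hx y hy
      obtain ⟨hx', hx''⟩ := (hmem x).mp hx
      obtain ⟨hy', hy''⟩ := (hmem y).mp hy
      obtain ⟨w⟩ := C.reachable_of_mem_supp hx'' hy''
      exact hwalk _ _ w hx
  · rintro ⟨⟨⟨x, hx⟩, hA⟩, hstep⟩
    refine ⟨(G.induce (S : Set N)).connectedComponentMk ⟨x, hAS hx⟩, ?_⟩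
    ext y
    simp only [mem_coe, Set.mem_image, SimpleGraph.ConnectedComponent.mem_supp_iff,
      SimpleGraph.ConnectedComponent.eq, Subtype.exists, exists_and_right, exists_eq_right]
    constructor
    · intro hy
      suffices ∀ z, LinkedIn G A x z → ∃ hz : z ∈ (S : Set N),
          (G.induce (S : Set N)).Reachable ⟨z, hz⟩ ⟨x, hAS hx⟩ from this y (hA x hx y hy)
      intro z hl
      induction hl with
      | refl => exact ⟨hAS hx, .refl _⟩
      | @tail b c _ h2 ih =>
        obtain ⟨hb, hr⟩ := ih
        refine ⟨hAS h2.2, (SimpleGraph.Adj.reachable ?_).trans hr⟩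
        simpa using h2.1.symm
    · rintro ⟨hy, ⟨w⟩⟩
      suffices ∀ (u v : (S : Set N)) (_ : (G.induce (S : Set N)).Walk u v), u.1 ∈ A →
        v.1 ∈ A from this _ _ w.reverse hx
      intro u v w
      induction w with
      | nil => exact id
      | @cons a b c h p ih =>
        exact fun hu => ih (hstep _ hu _ b.2 (by simpa using h))

variable (v : TUGame N)

theorem communicationGame_of_connectedOn (hA : ConnectedOn G A) :
    (communicationGame G v).value A = v.value A := by
  have : componentsIn G A = {A} := by
    ext B
    rw [mem_componentsIn_iff, mem_singleton]
    constructor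
    · rintro ⟨hBA, ⟨⟨x, hx⟩, -⟩, hB⟩
      exact hBA.antisymm (hA.subset_of_closed (hBA hx) hx hB)
    · rintro rfl
      exact ⟨Subset.rfl, hA, fun _ _ w hw _ => hw⟩
  simp [communicationGame, this]

theorem communicationGame_union [DecidableEq N] (hd : Disjoint A B)
    (hAB : ∀ x ∈ A, ∀ y ∈ B, ¬ G.Adj x y) :
    (communicationGame G v).value (A ∪ B) =
      (communicationGame G v).value A + (communicationGame G v).value B := by
  have hdis : Disjoint (componentsIn G A) (componentsIn G B) := by
    rw [Finset.disjoint_left]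
    intro C hC hC'
    rw [mem_componentsIn_iff] at hC hC'
    obtain ⟨x, hx⟩ := hC.2.1.1
    exact Finset.disjoint_left.mp hd (hC.1 hx) (hC'.1 hx)
  have : componentsIn G (A ∪ B) = componentsIn G A ∪ componentsIn G B := by
    ext C
    simp only [mem_union, mem_componentsIn_iff]
    constructor
    · rintro ⟨hC, hconn, hcl⟩
      obtain ⟨x, hx⟩ := hconn.1
      rcases mem_union.mp (hC hx) with h | h
      · refine .inl ⟨?_, hconn, fun u hu w hw => hcl u hu w (Or.inl hw)⟩
        refine hconn.subset_of_closed hx h fun u hu w hw h => ?_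
        exact (mem_union.mp (hC hw)).resolve_right fun hwB => hAB u hu w hwB h
      · refine .inr ⟨?_, hconn, fun u hu w hw => hcl u hu w (Or.inr hw)⟩
        refine hconn.subset_of_closed hx h fun u hu w hw h => ?_
        exact (mem_union.mp (hC hw)).resolve_left fun hwB => hAB w hwB u hu h.symm
    · rintro (⟨hC, hconn, hcl⟩ | ⟨hC, hconn, hcl⟩)
      · exact ⟨hC.trans subset_union_left, hconn, fun u hu w hw h => hw.elim
          (fun hw => hcl u hu w hw h) fun hw => absurd h (hAB _ (hC hu) _ hw)⟩
      · exact ⟨hC.trans subset_union_right, hconn, fun u hu w hw h => hw.elim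
          (fun hw => absurd h.symm (hAB _ hw _ (hC hu))) fun hw => hcl u hu w hw h⟩
  simp only [communicationGame, this]
  exact sum_union hdis

theorem communicationGame_of_isolated [DecidableEq N] (X L : Finset N) (hd : Disjoint X L)
    (hX : ∀ x ∈ X, ∀ y ∈ X ∪ L, ¬ G.Adj x y) :
    (communicationGame G v).value (X ∪ L) =
      ∑ x ∈ X, v.value {x} + (communicationGame G v).value L := by
  induction X using Finset.induction_on with
  | empty => simp
  | insert a X ha ih =>
    have h1 : insert a X ∪ L = {a} ∪ (X ∪ L) := by ext; simp
    have hd' := Finset.disjoint_insert_left.mp hd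
    rw [h1, communicationGame_union, ih hd'.2, sum_insert ha,
      communicationGame_of_connectedOn v connectedOn_singleton, add_assoc]
    · intro x hx y hy
      refine hX x (mem_insert_of_mem hx) y ?_
      rw [h1]; exact mem_union_right _ hy
    · simp [ha, hd'.1]
    · intro x hx y hy
      rw [mem_singleton.mp hx]
      refine hX a (mem_insert_self _ _) y ?_
      rw [h1]; exact mem_union_right _ hy

end Linked

/-! ### Relative weights and consequences of convexity of a game -/

namespace WeightSystem

variable {N : Type*} (W : WeightSystem N) {S T A B : Finset N} {i : N}

theorem mem_top_iff : i ∈ W.top T ↔ i ∈ T ∧ ∀ j ∈ T, W.priority j ≤ W.priority i := by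
  unfold WeightSystem.top coalitionPriority
  rw [mem_filter]
  refine and_congr_right fun hi => ⟨fun h j hj => ?_, fun h => ?_⟩
  · rw [h]; exact Finset.le_sup (f := W.priority) hj
  · exact le_antisymm (Finset.le_sup (f := W.priority) hi) (Finset.sup_le h)

theorem relWeight_of_mem_top (h : i ∈ W.top T) : W.relWeight T i = W.weight i := by
  simp [relWeight, h]

theorem relWeight_of_notMem_top (h : i ∉ W.top T) : W.relWeight T i = 0 := by
  simp [relWeight, h]

theorem relWeight_nonneg (T : Finset N) (i : N) : 0 ≤ W.relWeight T i := by
  unfold relWeight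
  split_ifs
  exacts [(W.weight_pos i).le, le_rfl]

theorem top_nonempty (h : T.Nonempty) : (W.top T).Nonempty := by
  obtain ⟨i, hi, h⟩ := T.exists_max_image W.priority h
  exact ⟨i, W.mem_top_iff.mpr ⟨hi, h⟩⟩

/-- Either `B` contains a top player of `T`, and then both coalitions have the same top priority, or
no player of `B` counts in `T`. This allows `T` to be replaced by one of its components. -/
theorem relWeight_subset (h : B ⊆ T) :
    (∀ i ∈ B, W.relWeight T i = W.relWeight B i) ∨ ∀ i ∈ B, W.relWeight T i = 0 := by
  by_cases hB : ∃ j ∈ B, j ∈ W.top T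
  · obtain ⟨j, hj, hjT⟩ := hB
    left
    intro i hi
    have : i ∈ W.top T ↔ i ∈ W.top B := by
      rw [mem_top_iff] at hjT
      simp only [mem_top_iff]
      exact ⟨fun h' => ⟨hi, fun l hl => h'.2 l (h hl)⟩,
        fun h' => ⟨h hi, fun l hl => (hjT.2 l hl).trans (h'.2 j hj)⟩⟩
    by_cases hiT : i ∈ W.top T
    · rw [W.relWeight_of_mem_top hiT, W.relWeight_of_mem_top (this.mp hiT)]
    · rw [W.relWeight_of_notMem_top hiT, W.relWeight_of_notMem_top (hiT ∘ this.mpr)]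
  · right
    exact fun i hi => W.relWeight_of_notMem_top fun h' => hB ⟨i, hi, h'⟩

variable [DecidableEq N] {W} {v : TUGame N}

theorem IsConvexGame.superadditive_of_mem_top (hv : W.IsConvexGame v) (hi : i ∈ W.top B) :
    v.value {i} + v.value (B.erase i) ≤ v.value B := by
  have h := hv {i} B (singleton_subset_iff.mpr (W.mem_top_iff.mp hi).1)
  rw [sum_singleton, W.relWeight_of_mem_top hi] at h
  have := nonneg_of_mul_nonneg_right h (W.weight_pos i)
  rw [Finset.erase_singleton, v.value_empty] at this
  linarith

/-- If all members of `B` outside `L` have higher priority than those in `L`, the worth that `B`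
creates beyond its part in `L` and its single players outside `L` is monotone. -/
theorem IsConvexGame.excess_mono (hv : W.IsConvexGame v) (L : Finset N) (hAB : A ⊆ B)
    (hL : ∀ x ∈ B \ L, ∀ y ∈ B ∩ L, W.priority y < W.priority x) :
    v.value A - v.value (A ∩ L) - ∑ x ∈ A \ L, v.value {x} ≤
      v.value B - v.value (B ∩ L) - ∑ x ∈ B \ L, v.value {x} := by
  induction B using Finset.strongInduction generalizing A with
  | H B ih =>
  by_cases hBL : B ⊆ L
  · simp [inter_eq_left.mpr hBL, inter_eq_left.mpr (hAB.trans hBL),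
      sdiff_eq_empty_iff_subset.mpr hBL, sdiff_eq_empty_iff_subset.mpr (hAB.trans hBL)]
  obtain ⟨x, hxB, hxL⟩ := Finset.not_subset.mp hBL
  have htop : ∀ i ∈ W.top B, i ∉ L := fun i hi hiL => by
    rw [mem_top_iff] at hi
    exact absurd (hi.2 x hxB) (not_le.mpr
      (hL x (mem_sdiff.mpr ⟨hxB, hxL⟩) i (mem_inter.mpr ⟨hi.1, hiL⟩)))
  have herase : ∀ (C : Finset N) (i : N), i ∈ C → i ∉ L →
      C.erase i ∩ L = C ∩ L ∧
      ∑ x ∈ C \ L, v.value {x} = v.value {i} + ∑ x ∈ C.erase i \ L, v.value {x} := by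
    intro C i hi hiL
    refine ⟨by grind, ?_⟩
    rw [Finset.erase_sdiff_comm, Finset.add_sum_erase (C \ L) (fun x => v.value {x})]
    exact mem_sdiff.mpr ⟨hi, hiL⟩
  -- The induction hypothesis for `B.erase i`, with its excess expressed through `B`: as `i ∉ L`,
  -- only the singleton term of `i` disappears.
  have hsub : ∀ i ∈ W.top B, ∀ C ⊆ B.erase i,
      v.value C - v.value (C ∩ L) - ∑ x ∈ C \ L, v.value {x} ≤ v.value (B.erase i) -
        v.value (B ∩ L) - (∑ x ∈ B \ L, v.value {x} - v.value {i}) := by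
    intro i hi C hC
    have hiB := (W.mem_top_iff.mp hi).1
    obtain ⟨h1, h2⟩ := herase B i hiB (htop i hi)
    have := ih (B.erase i) (erase_ssubset hiB) hC fun x hx y hy => hL x
      (sdiff_subset_sdiff (erase_subset _ _) Subset.rfl hx) y
      (inter_subset_inter_right (erase_subset _ _) hy)
    rw [h1] at this
    linarith
  -- If `A` contains all top players, the induction hypothesis bounds each weighted term of
  -- convexity by the weight times `gB - gA`, and the total weight is positive. Otherwise some top
  -- `i` is missing from `A`, so one passes from `A` to `B.erase i` and then adds `i` by
  -- superadditivity.
  by_cases hA : W.top B ⊆ A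
  · have hconv := hv A B hAB
    set gA := v.value A - v.value (A ∩ L) - ∑ x ∈ A \ L, v.value {x} with hgA
    set gB := v.value B - v.value (B ∩ L) - ∑ x ∈ B \ L, v.value {x} with hgB
    have hle : ∑ i ∈ A, W.relWeight B i *
        (v.value B - v.value (B.erase i) - v.value A + v.value (A.erase i)) ≤
        ∑ i ∈ A, W.relWeight B i * (gB - gA) := by
      refine sum_le_sum fun i hi => ?_
      by_cases hiB : i ∈ W.top B
      · refine mul_le_mul_of_nonneg_left ?_ (W.relWeight_nonneg B i)
        obtain ⟨h1, h2⟩ := herase A i hi (htop i hiB)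
        have := hsub i hiB (A.erase i) (erase_subset_erase i hAB)
        rw [h1] at this
        linarith
      · simp [W.relWeight_of_notMem_top hiB]
    rw [← sum_mul] at hle
    have hpos : 0 < ∑ i ∈ A, W.relWeight B i := by
      obtain ⟨i, hi⟩ := W.top_nonempty ⟨x, hxB⟩
      refine lt_of_lt_of_le ?_ (single_le_sum (fun j _ => W.relWeight_nonneg B j) (hA hi))
      rw [W.relWeight_of_mem_top hi]
      exact W.weight_pos i
    have := nonneg_of_mul_nonneg_right (hconv.trans hle) hpos
    linarith
  · obtain ⟨i, hiB, hiA⟩ := Finset.not_subset.mp hA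
    have h1 := hsub i hiB A fun y hy =>
      mem_erase.mpr ⟨fun h => hiA (h ▸ hy), hAB hy⟩
    have h2 := hv.superadditive_of_mem_top hiB
    linarith

end WeightSystem

/-! ### Convexity of the communication game around a star center -/

section Sufficiency

variable {N : Type*} [DecidableEq N] {G : SimpleGraph N} {W : WeightSystem N} {v : TUGame N}
  {S T A B : Finset N} {c i : N}

theorem communicationGame_sub_erase (hBT : B ⊆ T) (hcl : ∀ u ∈ B, ∀ w ∈ T, G.Adj u w → w ∈ B)
    (hi : i ∈ B) :
    (communicationGame G v).value T - (communicationGame G v).value (T.erase i) =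
      (communicationGame G v).value B - (communicationGame G v).value (B.erase i) := by
  have h1 : T = B ∪ T \ B := (union_sdiff_of_subset hBT).symm
  have h2 : T.erase i = B.erase i ∪ T \ B := by grind
  have hadj : ∀ x ∈ B, ∀ y ∈ T \ B, ¬ G.Adj x y := fun x hx y hy h =>
    (mem_sdiff.mp hy).2 (hcl x hx y (mem_sdiff.mp hy).1 h)
  rw [h2]
  nth_rewrite 1 [h1]
  rw [communicationGame_union v disjoint_sdiff hadj, communicationGame_union v
    (disjoint_sdiff.mono_left (erase_subset _ _)) fun x hx => hadj x (mem_of_mem_erase hx)]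
  ring

/-- Convexity of the communication game only has to be checked for connected coalitions. -/
theorem isConvexGame_communicationGame_of_connectedOn
    (h : ∀ A B : Finset N, ConnectedOn G A → ConnectedOn G B → A ⊆ B →
      0 ≤ ∑ i ∈ A, W.relWeight B i *
        (v.value B - (communicationGame G v).value (B.erase i)
          - v.value A + (communicationGame G v).value (A.erase i))) :
    W.IsConvexGame (communicationGame G v) := by
  intro S T hST
  induction S using Finset.strongInduction with
  | H S ih =>
  rcases S.eq_empty_or_nonempty with rfl | ⟨x, hx⟩
  · simp
  obtain ⟨A, hAS, hxA, hA, hAcl⟩ := exists_component (G := G) hx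
  obtain ⟨B, hBT, hxB, hB, hBcl⟩ := exists_component (G := G) (hST hx)
  have hAB : A ⊆ B := hA.subset_of_closed hxA hxB fun u hu w hw => hBcl u hu w (hST (hAS hw))
  rw [← sum_sdiff hAS]
  refine add_nonneg ?_ ?_
  · refine (ih (S \ A) (sdiff_ssubset hAS ⟨x, hxA⟩) (sdiff_subset.trans hST)).trans_eq ?_
    refine sum_congr rfl fun i hi => ?_
    have := communicationGame_sub_erase (G := G) (v := v) (sdiff_subset (s := S) (t := A))
      (fun u hu w hw huw => mem_sdiff.mpr ⟨hw, fun hwA => (mem_sdiff.mp hu).2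
        (hAcl w hwA u (mem_sdiff.mp hu).1 huw.symm)⟩) hi
    congr 1
    linarith
  · have hrw : ∀ i ∈ A, (communicationGame G v).value T - (communicationGame G v).value (T.erase i)
        - (communicationGame G v).value S + (communicationGame G v).value (S.erase i) =
        v.value B - (communicationGame G v).value (B.erase i)
          - v.value A + (communicationGame G v).value (A.erase i) := by
      intro i hi
      have h1 := communicationGame_sub_erase (v := v) hBT hBcl (hAB hi)
      have h2 := communicationGame_sub_erase (v := v) hAS hAcl hi
      rw [communicationGame_of_connectedOn v hB] at h1
      rw [communicationGame_of_connectedOn v hA] at h2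
      linarith
    rw [sum_congr rfl fun i hi => by rw [hrw i hi]]
    rcases W.relWeight_subset hBT with hw | hw
    · rw [sum_congr rfl fun i hi => by rw [hw i (hAB hi)]]
      exact h A B hA hB hAB
    · rw [sum_congr rfl fun i hi => by rw [hw i (hAB hi), zero_mul]]
      simp

/-- A walk from `c` that enters the leaf `i` must return to `c`, so it can be restarted there. -/
theorem ConnectedOn.erase_leaf (hB : ConnectedOn G B) (hc : c ∈ B) (hic : i ≠ c)
    (hi : ∀ w ∈ B, G.Adj i w → w = c) : ConnectedOn G (B.erase i) := by
  refine .of_center (mem_erase.mpr ⟨hic.symm, hc⟩) fun y hy => ?_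
  obtain ⟨hyi, hyB⟩ := mem_erase.mp hy
  suffices ∀ z, LinkedIn G B c z → z ∈ B ∧ (z ≠ i → LinkedIn G (B.erase i) c z) from
    (this y (hB.2 c hc y hyB)).2 hyi
  intro z hz
  induction hz with
  | refl => exact ⟨hc, fun _ => .refl⟩
  | @tail a b _ h2 ih =>
    refine ⟨h2.2, fun hb => ?_⟩
    by_cases ha : a = i
    · subst ha
      rw [hi b h2.2 h2.1]
      exact .refl
    · exact .tail (ih.2 ha) ⟨h2.1, mem_erase.mpr ⟨hb, h2.2⟩⟩

theorem communicationGame_erase_center (L : Finset N) (hcL : c ∉ L)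
    (hleaf : ∀ z ∈ B, z ≠ c → z ∉ L → ∀ w ∈ B, G.Adj z w → w = c)
    (hL : (B ∩ L).Nonempty → ConnectedOn G (B ∩ L)) :
    (communicationGame G v).value (B.erase c) =
      v.value (B.erase c ∩ L) + ∑ x ∈ B.erase c \ L, v.value {x} := by
  have h1 : B.erase c ∩ L = B ∩ L := by grind
  have h2 : (communicationGame G v).value (B ∩ L) = v.value (B ∩ L) := by
    rcases (B ∩ L).eq_empty_or_nonempty with h | h
    · rw [h, TUGame.value_empty, TUGame.value_empty]
    · exact communicationGame_of_connectedOn v (hL h)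
  conv_lhs => rw [← sdiff_union_inter (B.erase c) L]
  rw [communicationGame_of_isolated, h1, h2, add_comm]
  · exact disjoint_sdiff_inter _ _
  · intro x hx y hy h
    rw [sdiff_union_inter] at hy
    have hx' := mem_erase.mp (mem_sdiff.mp hx).1
    exact (mem_erase.mp hy).1 (hleaf x hx'.2 hx'.1 (mem_sdiff.mp hx).2 y (mem_erase.mp hy).2 h)

/-- Term by term comparison with convexity of `v`. Only `i = c` changes the values, and the change
is the difference of the excesses of `B.erase c` and `A.erase c`, nonnegative by `excess_mono`. -/
theorem convexity_of_center (hv : W.IsConvexGame v) (L : Finset N)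
    (hA : ConnectedOn G A) (hB : ConnectedOn G B) (hAB : A ⊆ B) (hcA : c ∈ A) (hcL : c ∉ L)
    (hleaf : ∀ z ∈ B, z ≠ c → z ∉ L → ∀ w ∈ B, G.Adj z w → w = c)
    (hp : ∀ x ∈ B \ L, ∀ y ∈ B ∩ L, W.priority y < W.priority x)
    (hAL : (A ∩ L).Nonempty → ConnectedOn G (A ∩ L))
    (hBL : (B ∩ L).Nonempty → ConnectedOn G (B ∩ L)) :
    0 ≤ ∑ i ∈ A, W.relWeight B i *
        (v.value B - (communicationGame G v).value (B.erase i)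
          - v.value A + (communicationGame G v).value (A.erase i)) := by
  refine (hv A B hAB).trans (sum_le_sum fun i hi => ?_)
  by_cases hiB : i ∈ W.top B
  swap
  · simp [W.relWeight_of_notMem_top hiB]
  refine mul_le_mul_of_nonneg_left ?_ (W.relWeight_nonneg B i)
  have hleafA : ∀ z ∈ A, z ≠ c → z ∉ L → ∀ w ∈ A, G.Adj z w → w = c :=
    fun z hz hzc hzL w hw => hleaf z (hAB hz) hzc hzL w (hAB hw)
  by_cases hic : i = c
  · subst hic
    rw [communicationGame_erase_center L hcL hleaf hBL,
      communicationGame_erase_center L hcL hleafA hAL]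
    have := hv.excess_mono L (erase_subset_erase i hAB) fun x hx y hy => hp x
      (sdiff_subset_sdiff (erase_subset _ _) Subset.rfl hx) y
      (inter_subset_inter_right (erase_subset _ _) hy)
    linarith
  · have hiL : i ∉ L := fun hiL => by
      have h1 := (W.mem_top_iff.mp hiB).2 c (hAB hcA)
      have h2 := hp c (mem_sdiff.mpr ⟨hAB hcA, hcL⟩) i (mem_inter.mpr ⟨hAB hi, hiL⟩)
      omega
    rw [communicationGame_of_connectedOn v (hB.erase_leaf (hAB hcA) hic
        (hleaf i (hAB hi) hic hiL)),
      communicationGame_of_connectedOn v (hA.erase_leaf hcA hic (hleafA i hi hic hiL))]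

/-- The convexity inequality for connected coalitions `A ⊆ B` when the members of `B` outside a
lower set `L` can only be adjacent to `c`. -/
theorem convexity_of_leaves (hv : W.IsConvexGame v) (L : Finset N)
    (hA : ConnectedOn G A) (hB : ConnectedOn G B) (hAB : A ⊆ B) (hcL : c ∉ L)
    (hiA : i ∈ A) (hiL : i ∉ L)
    (hleaf : ∀ z ∈ B, z ≠ c → z ∉ L → ∀ w ∈ B, G.Adj z w → w = c)
    (hp : ∀ x ∈ B \ L, ∀ y ∈ B ∩ L, W.priority y < W.priority x)
    (hAL : (A ∩ L).Nonempty → ConnectedOn G (A ∩ L))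
    (hBL : (B ∩ L).Nonempty → ConnectedOn G (B ∩ L)) :
    0 ≤ ∑ i ∈ A, W.relWeight B i *
        (v.value B - (communicationGame G v).value (B.erase i)
          - v.value A + (communicationGame G v).value (A.erase i)) := by
  by_cases hcA : c ∈ A
  · exact convexity_of_center hv L hA hB hAB hcA hcL hleaf hp hAL hBL
  -- Without `c`, the leaf `i` has no neighbour in `A`, so the connected set `A` is `{i}`.
  have hic : i ≠ c := fun h => hcA (h ▸ hiA)
  have hAi : A = {i} := hA.eq_singleton hiA fun w hw h =>
    hcA (hleaf i (hAB hiA) hic hiL w (hAB hw) h ▸ hw)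
  subst hAi
  rw [sum_singleton, erase_singleton, TUGame.value_empty, add_zero]
  by_cases hiB : i ∈ W.top B
  swap
  · simp [W.relWeight_of_notMem_top hiB]
  refine mul_nonneg (W.relWeight_nonneg B i) ?_
  have hiB' := (W.mem_top_iff.mp hiB).1
  have hsup := hv.superadditive_of_mem_top hiB
  have : (communicationGame G v).value (B.erase i) = v.value (B.erase i) := by
    by_cases hcB : c ∈ B
    · exact communicationGame_of_connectedOn v
        (hB.erase_leaf hcB hic (hleaf i hiB' hic hiL))
    · have : B = {i} := hB.eq_singleton hiB' fun w hw h =>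
        hcB (hleaf i hiB' hic hiL w hw h ▸ hw)
      rw [this, erase_singleton, TUGame.value_empty, TUGame.value_empty]
  linarith

end Sufficiency

/-! ### Unique paths in acyclic graphs -/

namespace SimpleGraph

variable {N : Type*} {G : SimpleGraph N} {u v w x : N}

theorem IsAcyclic.support_subset (hG : G.IsAcyclic) {P Q : G.Walk u v} (hP : P.IsPath) :
    P.support ⊆ Q.support := by
  classical
  have hPQ : P = Q.bypass :=
    congrArg Subtype.val ((hG.subsingleton_path u v).elim ⟨P, hP⟩ Q.toPath)
  rw [hPQ]
  exact Q.support_bypass_subset_support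

theorem IsAcyclic.not_adj_of_common_neighbor (hG : G.IsAcyclic) (huv : u ≠ v) (hu : G.Adj u x)
    (hv : G.Adj x v) : ¬ G.Adj u v := by
  intro h
  have hP : (Walk.cons hu (Walk.cons hv Walk.nil)).IsPath := by
    simp [Walk.cons_isPath_iff, hu.ne, hv.ne, huv]
  have := hG.support_subset (Q := h.toWalk) hP (a := x) (by simp)
  simp [hu.ne', hv.ne] at this

theorem IsAcyclic.not_adj_of_path_three (hG : G.IsAcyclic) {a i j b : N} (hai : G.Adj a i)
    (hij : G.Adj i j) (hjb : G.Adj j b) (haj : a ≠ j) (hib : i ≠ b) (hab : a ≠ b) :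
    ¬ G.Adj a b := by
  intro h
  have hP : (Walk.cons hai (Walk.cons hij (Walk.cons hjb Walk.nil))).IsPath := by
    simp [Walk.cons_isPath_iff, hai.ne, hij.ne, hjb.ne, haj, hib, hab]
  have := hG.support_subset (Q := h.toWalk) hP (a := i) (by simp)
  simp [hai.ne', hib] at this

end SimpleGraph

/-! ### Subtrees as path-closed sets -/

section PathClosed

variable {N : Type*} {G : SimpleGraph N} {A B : Finset N} {u v w x y z : N}

/-- `A` contains all paths of `G` between its members. -/
def PathClosed (G : SimpleGraph N) (A : Finset N) : Prop :=
  ∀ u ∈ A, ∀ v ∈ A, ∀ P : G.Walk u v, P.IsPath → ∀ w ∈ P.support, w ∈ A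

theorem LinkedIn.exists_walk (h : LinkedIn G A x y) (hx : x ∈ A) :
    ∃ P : G.Walk x y, ∀ w ∈ P.support, w ∈ A := by
  induction h with
  | refl => exact ⟨.nil, by simpa using hx⟩
  | tail _ h2 ih =>
    obtain ⟨P, hP⟩ := ih
    refine ⟨P.concat h2.1, fun w hw => ?_⟩
    rw [SimpleGraph.Walk.support_concat, List.mem_append] at hw
    rcases hw with hw | hw
    · exact hP w hw
    · rw [List.mem_singleton.mp hw]; exact h2.2

theorem LinkedIn.of_walk (P : G.Walk x y) (h : ∀ w ∈ P.support, w ∈ A) : LinkedIn G A x y := by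
  induction P with
  | nil => exact .refl
  | cons hadj P ih =>
    refine .head ⟨hadj, h _ (by simp)⟩ (ih fun w hw => h w (by simp [hw]))

theorem ConnectedOn.pathClosed (hG : G.IsAcyclic) (hA : ConnectedOn G A) : PathClosed G A := by
  intro u hu v hv P hP w hw
  obtain ⟨Q, hQ⟩ := (hA.2 u hu v hv).exists_walk hu
  exact hQ w (hG.support_subset hP hw)

theorem PathClosed.connectedOn (hG : G.Connected) (hA : PathClosed G A) (hne : A.Nonempty) :
    ConnectedOn G A := by
  classical
  refine ⟨hne, fun x hx y hy => ?_⟩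
  obtain ⟨P⟩ := hG x y
  exact .of_walk P.bypass (hA x hx y hy _ P.bypass_isPath)

theorem ConnectedOn.inter [DecidableEq N] (hG : G.IsTree) (hA : ConnectedOn G A)
    (hB : ConnectedOn G B) (hne : (A ∩ B).Nonempty) : ConnectedOn G (A ∩ B) := by
  refine PathClosed.connectedOn hG.connected (fun u hu v hv P hP w hw => ?_) hne
  rw [mem_inter] at hu hv ⊢
  exact ⟨hA.pathClosed hG.isAcyclic u hu.1 v hv.1 P hP w hw,
    hB.pathClosed hG.isAcyclic u hu.2 v hv.2 P hP w hw⟩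

theorem ConnectedOn.union [DecidableEq N] (hA : ConnectedOn G A)
    (hB : ConnectedOn G B) (hx : x ∈ A) (hy : y ∈ B) (h : G.Adj x y) : ConnectedOn G (A ∪ B) := by
  refine .of_center (mem_union_left _ hx) fun z hz => ?_
  rcases mem_union.mp hz with hz | hz
  · exact (hA.2 x hx z hz).mono subset_union_left
  · exact .head ⟨h, mem_union_right _ hy⟩ ((hB.2 y hy z hz).mono subset_union_right)

theorem ConnectedOn.insert [DecidableEq N] (hA : ConnectedOn G A) (hy : y ∈ A)
    (h : G.Adj x y) : ConnectedOn G (insert x A) :=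
  insert_eq x A ▸ connectedOn_singleton.union hA (mem_singleton_self x) hy h

/-- In an acyclic graph, edges between two disjoint connected sets have the same endpoint. -/
theorem ConnectedOn.eq_of_adj_of_adj (hG : G.IsAcyclic) (hA : ConnectedOn G A)
    (hB : ConnectedOn G B) (hd : Disjoint A B) {z z' w w' : N} (hz : z ∈ A) (hz' : z' ∈ A)
    (hw : w ∈ B) (hw' : w' ∈ B) (h : G.Adj z w) (h' : G.Adj z' w') : z = z' := by
  classical
  obtain ⟨P, hP⟩ := (hA.2 z hz z' hz').exists_walk hz
  obtain ⟨Q, hQ⟩ := (hB.2 w hw w' hw').exists_walk hw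
  -- The path through `A` to `z'` and then `w'` must stay inside the support of the walk from `z`
  -- into `B`; that walk meets `A` only in `z`.
  have hPb : (P.bypass.concat h').IsPath := by
    refine P.bypass_isPath.concat (fun hmem => ?_) h'
    exact Finset.disjoint_left.mp hd (hP _ (P.support_bypass_subset_support hmem)) hw'
  have hmem := hG.support_subset (Q := SimpleGraph.Walk.cons h Q) hPb (a := z')
    (by simp [SimpleGraph.Walk.support_concat])
  rw [SimpleGraph.Walk.support_cons, List.mem_cons] at hmem
  exact (hmem.resolve_right fun hm => Finset.disjoint_left.mp hd hz' (hQ _ hm)).symm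

theorem isStarOn_iff {c : N} : IsStarOn G A c ↔
    c ∈ A ∧ ∀ x ∈ A, ∀ y ∈ A, G.Adj x y ↔ x ≠ y ∧ (x = c ∨ y = c) := by
  constructor
  · rintro ⟨hc, h⟩
    refine ⟨hc, fun x hx y hy => ?_⟩
    have : (G.induce (A : Set N)).Adj ⟨x, hx⟩ ⟨y, hy⟩ ↔
        (SimpleGraph.starGraph (⟨c, hc⟩ : (A : Set N))).Adj ⟨x, hx⟩ ⟨y, hy⟩ := by rw [h]
    simpa [SimpleGraph.starGraph_adj] using this
  · rintro ⟨hc, h⟩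
    refine ⟨hc, ?_⟩
    ext x y
    rw [SimpleGraph.starGraph_adj, ne_eq, Subtype.ext_iff, Subtype.ext_iff, Subtype.ext_iff]
    exact h x.1 x.2 y.1 y.2

theorem IsStarOn.connectedOn {c : N} (h : IsStarOn G A c) : ConnectedOn G A := by
  rw [isStarOn_iff] at h
  refine .of_center h.1 fun y hy => ?_
  by_cases hcy : c = y
  · subst hcy; exact .refl
  · exact .single ⟨(h.2 c h.1 y hy).mpr ⟨hcy, .inl rfl⟩, hy⟩

end PathClosed

namespace WeightSystem

variable {N : Type*} (W : WeightSystem N)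

theorem priority_mem (i : N) : 1 ≤ W.priority i ∧ W.priority i ≤ W.numLevels := by
  have : W.priority i ∈ Set.range W.priority := ⟨i, rfl⟩
  rwa [W.range_priority] at this

theorem exists_priority_eq {k : ℕ} (h1 : 1 ≤ k) (h2 : k ≤ W.numLevels) :
    ∃ i, W.priority i = k := by
  have : k ∈ Set.range W.priority := by rw [W.range_priority]; exact ⟨h1, h2⟩
  exact this

theorem mem_band [Fintype N] {a b : ℕ} {i : N} :
    i ∈ W.band a b ↔ a < W.priority i ∧ W.priority i ≤ b := by
  simp [band]

theorem mem_band_zero [Fintype N] {b : ℕ} {i : N} :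
    i ∈ W.band 0 b ↔ W.priority i ≤ b := by
  rw [mem_band]
  exact and_iff_right (W.priority_mem i).1

end WeightSystem

/-! ### Chains of stars preserve convexity -/

section StarChain

variable {N : Type*} [Fintype N] {W : WeightSystem N} {G : SimpleGraph N}
  [DecidableRel G.Adj] {m : ℕ} {k : ℕ → ℕ} {c : ℕ → N}

/-- The structure of a priority decreasing tree that preserves convexity: a chain of stars. -/
structure IsStarChain (W : WeightSystem N) (G : SimpleGraph N) [DecidableRel G.Adj]
    (m : ℕ) (k : ℕ → ℕ) (c : ℕ → N) : Prop where
  one_le : 1 ≤ m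
  strictAntiOn : StrictAntiOn k (Set.Icc 1 (m + 1))
  last : k (m + 1) = 0
  star : ∀ l, 1 ≤ l → l ≤ m → IsStarOn G (W.band (k (l + 1)) (k l)) (c l)
  priority_center : ∀ l, 1 ≤ l → l ≤ m → W.priority (c l) = k l
  edge : ∀ l, 1 ≤ l → l + 1 ≤ m →
    ∃ y ∈ W.band (k (l + 2)) (k (l + 1)), W.priority y = k (l + 1) ∧
      G.interedges (W.band (k (l + 1)) (k l)) (W.band (k (l + 2)) (k (l + 1))) = {(c l, y)}

theorem IsStarChain.exists_edge (h : IsStarChain W G m k c) {l : ℕ} (h1 : 1 ≤ l)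
    (h2 : l + 1 ≤ m) : ∃ y ∈ W.band (k (l + 2)) (k (l + 1)), G.Adj (c l) y := by
  obtain ⟨y, hy, -, he⟩ := h.edge l h1 h2
  have : (c l, y) ∈ G.interedges (W.band (k (l + 1)) (k l)) (W.band (k (l + 2)) (k (l + 1))) := by
    rw [he]; exact mem_singleton_self _
  exact ⟨y, hy, (Rel.mem_interedges_iff.mp this).2.2⟩

theorem IsStarChain.anti (h : IsStarChain W G m k c) {l : ℕ} (h1 : 1 ≤ l) (h2 : l ≤ m) :
    k (l + 1) < k l :=
  h.strictAntiOn ⟨h1, by omega⟩ ⟨by omega, by omega⟩ (by omega)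

variable [DecidableEq N]

theorem WeightSystem.band_union_band {a b : ℕ} (h : a ≤ b) :
    W.band a b ∪ W.band 0 a = W.band 0 b := by
  ext i
  rw [mem_union, W.mem_band, W.mem_band_zero, W.mem_band_zero]
  omega

theorem IsStarChain.connectedOn_band_zero (h : IsStarChain W G m k c) :
    ∀ n l, l + n = m → 1 ≤ l → ConnectedOn G (W.band 0 (k l)) := by
  intro n
  induction n with
  | zero =>
    rintro l rfl hl
    have := (h.star l hl le_rfl).connectedOn
    rwa [Nat.add_zero, h.last] at this
  | succ n ih =>
    intro l hlm hl
    obtain ⟨y, hy, hcy⟩ := h.exists_edge hl (by omega)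
    rw [← W.band_union_band (h.anti hl (by omega)).le]
    refine (h.star l hl (by omega)).connectedOn.union (ih (l + 1) (by omega) (by omega))
      (isStarOn_iff.mp (h.star l hl (by omega))).1 ?_ hcy
    rw [W.mem_band] at hy
    exact W.mem_band_zero.mpr hy.2

/-- All lower bands together are connected and attached to `c l`; by acyclicity no other member of
the star has a neighbour in any of them, not just in the next band. -/
theorem IsStarChain.eq_center (h : IsStarChain W G m k c) (hG : G.IsAcyclic) {l : ℕ} (h1 : 1 ≤ l)
    (h2 : l ≤ m) {z w : N} (hz : z ∈ W.band (k (l + 1)) (k l)) (hzc : z ≠ c l)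
    (hw : W.priority w ≤ k l) (hzw : G.Adj z w) : w = c l := by
  have hstar := isStarOn_iff.mp (h.star l h1 h2)
  by_cases hwl : k (l + 1) < W.priority w
  · exact (((hstar.2 z hz w (W.mem_band.mpr ⟨hwl, hw⟩)).mp hzw).2).resolve_left hzc
  · have hlm : l ≠ m := by
      rintro rfl
      rw [h.last] at hwl
      exact hwl (W.priority_mem w).1
    obtain ⟨y, hy, hcy⟩ := h.exists_edge h1 (by omega)
    refine absurd ?_ hzc
    refine (h.star l h1 h2).connectedOn.eq_of_adj_of_adj hG
      (h.connectedOn_band_zero (m - (l + 1)) (l + 1) (by omega) (by omega)) ?_ hz hstar.1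
      (W.mem_band_zero.mpr (not_lt.mp hwl)) (W.mem_band_zero.mpr (W.mem_band.mp hy).2) hzw hcy
    rw [Finset.disjoint_left]
    intro i hi hi'
    rw [W.mem_band] at hi
    rw [W.mem_band_zero] at hi'
    omega

theorem IsStarChain.preservesConvexity (h : IsStarChain W G m k c) (hG : G.IsTree)
    (hk : k 1 = W.numLevels) : PreservesConvexity G W := by
  intro v hv
  refine isConvexGame_communicationGame_of_connectedOn fun A B hA hB hAB => ?_
  by_cases hex : ∃ i ∈ A, i ∈ W.top B
  swap
  · rw [sum_eq_zero fun i hi => ?_]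
    rw [W.relWeight_of_notMem_top fun hi' => hex ⟨i, hi, hi'⟩, zero_mul]
  obtain ⟨i, hiA, hiB⟩ := hex
  have hiB' := (W.mem_top_iff.mp hiB).2
  -- The shift by `2` makes the least witness `n` give the band index `l = n + 1 ≥ 1`; minimality,
  -- or `k 1 = W.numLevels` if `n = 0`, gives the upper bound.
  have hfind : ∃ l, k (l + 2) < W.priority i := by
    refine ⟨m - 1, ?_⟩
    have := h.one_le
    rw [show m - 1 + 2 = m + 1 by omega, h.last]
    exact (W.priority_mem i).1
  obtain ⟨l, h1, h2, hl1, hl2⟩ :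
      ∃ l, 1 ≤ l ∧ l ≤ m ∧ k (l + 1) < W.priority i ∧ W.priority i ≤ k l := by
    refine ⟨Nat.find hfind + 1, by omega, ?_, Nat.find_spec hfind, ?_⟩
    · have : Nat.find hfind ≤ m - 1 := Nat.find_min' hfind (by
        have := h.one_le
        rw [show m - 1 + 2 = m + 1 by omega, h.last]
        exact (W.priority_mem i).1)
      have := h.one_le
      omega
    · rcases hn : Nat.find hfind with _ | n
      · rw [hk]; exact (W.priority_mem i).2
      · exact not_lt.mp (Nat.find_min hfind (m := n) (by omega))
  have hout : ∀ z ∈ B, z ∉ W.band 0 (k (l + 1)) → z ∈ W.band (k (l + 1)) (k l) := by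
    intro z hz hzL
    rw [W.mem_band_zero, not_le] at hzL
    exact W.mem_band.mpr ⟨hzL, (hiB' z hz).trans hl2⟩
  have hinter : ∀ C : Finset N, ConnectedOn G C → (C ∩ W.band 0 (k (l + 1))).Nonempty →
      ConnectedOn G (C ∩ W.band 0 (k (l + 1))) := by
    intro C hC hne
    refine hC.inter hG ?_ hne
    by_cases hlm : l = m
    · obtain ⟨x, hx⟩ := hne
      have hx := W.mem_band_zero.mp (mem_inter.mp hx).2
      rw [hlm, h.last] at hx
      exact absurd (W.priority_mem x).1 (by omega)
    · exact h.connectedOn_band_zero (m - (l + 1)) (l + 1) (by omega) (by omega)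
  refine convexity_of_leaves (c := c l) (i := i) hv (W.band 0 (k (l + 1))) hA hB hAB ?_ hiA ?_ ?_ ?_
    (hinter A hA) (hinter B hB)
  · have := (isStarOn_iff.mp (h.star l h1 h2)).1
    rw [W.mem_band] at this
    rw [W.mem_band_zero]
    omega
  · rw [W.mem_band_zero]
    omega
  · intro z hz hzc hzL w hw hzw
    exact h.eq_center hG.isAcyclic h1 h2 (hout z hz hzL) hzc ((hiB' w hw).trans hl2) hzw
  · intro x hx y hy
    have hx := (W.mem_band.mp (hout x (mem_sdiff.mp hx).1 (mem_sdiff.mp hx).2)).1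
    have hy := W.mem_band_zero.mp (mem_inter.mp hy).2
    omega

end StarChain

/-! ### Building the chain of stars from the forbidden path -/

section Unimodal

variable {N : Type*} {W : WeightSystem N} {G : SimpleGraph N}

/-- The path from `u` to `v` is covered by the paths from the root to `u` and to `v`, along which
priorities are at least those of the respective end. -/
theorem IsPriorityDecreasingTree.min_le_priority (hG : IsPriorityDecreasingTree G W) {u v w : N}
    {P : G.Walk u v} (hP : P.IsPath) (hw : w ∈ P.support) :
    min (W.priority u) (W.priority v) ≤ W.priority w := by
  classical
  obtain ⟨hT, r, hr⟩ := hG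
  obtain ⟨Pu⟩ := hT.connected r u
  obtain ⟨Pv⟩ := hT.connected r v
  have hmem := hT.isAcyclic.support_subset (Q := Pu.bypass.reverse.append Pv.bypass) hP hw
  rw [SimpleGraph.Walk.mem_support_append_iff, SimpleGraph.Walk.support_reverse,
    List.mem_reverse] at hmem
  rcases hmem with h | h
  · exact (min_le_left _ _).trans (hr w u _ Pu.bypass_isPath h)
  · exact (min_le_right _ _).trans (hr w v _ Pv.bypass_isPath h)

theorem IsPriorityDecreasingTree.min_le_of_adj (hG : IsPriorityDecreasingTree G W) {u v w : N}
    (huv : u ≠ v) (hu : G.Adj u w) (hv : G.Adj w v) :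
    min (W.priority u) (W.priority v) ≤ W.priority w := by
  refine hG.min_le_priority
    (P := SimpleGraph.Walk.cons hu (SimpleGraph.Walk.cons hv SimpleGraph.Walk.nil)) ?_ (by simp)
  simp [SimpleGraph.Walk.cons_isPath_iff, hu.ne, hv.ne, huv]

/-- There is no path `a, i, j, b` with `max (p a) (p b) ≤ p i ≤ p j`. -/
def NoDominatedPath (G : SimpleGraph N) (W : WeightSystem N) : Prop :=
  ∀ a i j b, G.Adj a i → G.Adj i j → G.Adj j b → a ≠ j → i ≠ b →
    W.priority i ≤ W.priority j → W.priority a ≤ W.priority i → W.priority b ≤ W.priority i → False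

variable [Fintype N]

/-- The data of one link of a chain of stars: a star on the priorities `k' + 1, …, k`, attached to
the lower priorities by a single edge. -/
theorem exists_star_of_noDominatedPath (hG : IsPriorityDecreasingTree G W)
    (hno : NoDominatedPath G W) {k : ℕ} (h1 : 1 ≤ k) (hk : k ≤ W.numLevels)
    (hL : PathClosed G (W.band 0 k)) :
    ∃ (c : N) (k' : ℕ), W.priority c = k ∧ k' < k ∧ IsStarOn G (W.band k' k) c ∧
      (1 ≤ k' → PathClosed G (W.band 0 k') ∧ ∃ y, W.priority y = k' ∧
        ∀ z ∈ W.band k' k, ∀ w ∈ W.band 0 k', G.Adj z w ↔ z = c ∧ w = y) := by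
  classical
  have hT := hG.1
  have hac := hT.isAcyclic
  -- Among the players of priority `k`, one with two neighbours of priority at most `k` is
  -- preferred; this later excludes `W.priority y = k`.
  obtain ⟨c, hc, hchoice⟩ : ∃ c, W.priority c = k ∧ ∀ t, W.priority t = k →
      (∃ x y, x ≠ y ∧ G.Adj t x ∧ G.Adj t y ∧ W.priority x ≤ k ∧ W.priority y ≤ k) →
      ∃ x y, x ≠ y ∧ G.Adj c x ∧ G.Adj c y ∧ W.priority x ≤ k ∧ W.priority y ≤ k := by
    by_cases hex : ∃ t, W.priority t = k ∧
      ∃ x y, x ≠ y ∧ G.Adj t x ∧ G.Adj t y ∧ W.priority x ≤ k ∧ W.priority y ≤ k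
    · obtain ⟨t, ht, hxy⟩ := hex
      exact ⟨t, ht, fun _ _ _ => hxy⟩
    · obtain ⟨c, hc⟩ := W.exists_priority_eq h1 hk
      exact ⟨c, hc, fun t ht hxy => absurd ⟨t, ht, hxy⟩ hex⟩
  have hfirst : ∀ z, W.priority z ≤ k → z ≠ c → ¬ G.Adj c z →
      ∃ (x b : N) (h : G.Adj c x) (Q : G.Walk x z), (SimpleGraph.Walk.cons h Q).IsPath ∧
        G.Adj x b ∧ b ≠ c ∧ W.priority x ≤ k ∧ W.priority b ≤ k ∧
        ∀ w ∈ Q.support, W.priority w ≤ k := by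
    intro z hz hzc hcz
    obtain ⟨P⟩ := hT.connected c z
    have hP := P.bypass_isPath
    have hmem := hL c (W.mem_band_zero.mpr hc.le) z (W.mem_band_zero.mpr hz) _ hP
    simp only [W.mem_band_zero] at hmem
    generalize P.bypass = Q at hP hmem
    cases Q with
    | nil => exact absurd rfl hzc
    | @cons _ x _ h Q =>
      cases Q with
      | nil => exact absurd h hcz
      | @cons _ b _ h' Q =>
        refine ⟨x, b, h, .cons h' Q, hP, h', ?_, hmem _ (by simp), hmem _ (by simp),
          fun w hw => hmem w (by simp at hw ⊢; tauto)⟩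
        rintro rfl
        rw [SimpleGraph.Walk.cons_isPath_iff] at hP
        exact hP.2 (by simp)
  -- Otherwise `b, y, c, x` is a forbidden path: `p b ≤ p y` holds because `y` lies between `c` and
  -- `b`.
  have hsolo : ∀ y b x, G.Adj c y → G.Adj y b → b ≠ c → W.priority b ≤ k → G.Adj c x → x ≠ y →
      W.priority y ≤ k → W.priority y < W.priority x := by
    intro y b x hcy hyb hbc hb hcx hxy hy
    by_contra hlt
    have hU := hG.min_le_of_adj hbc.symm hcy hyb
    rw [hc, min_eq_right hb] at hU
    exact hno b y c x hyb.symm hcy.symm hcx hbc hxy.symm (by omega) hU (by omega)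
  by_cases hex : ∃ y b, G.Adj c y ∧ G.Adj y b ∧ b ≠ c ∧ W.priority y ≤ k ∧ W.priority b ≤ k
  swap
  · refine ⟨c, 0, hc, h1, isStarOn_iff.mpr ⟨W.mem_band_zero.mpr hc.le, ?_⟩, fun h => by omega⟩
    have hadj : ∀ z, W.priority z ≤ k → z ≠ c → G.Adj c z := by
      intro z hz hzc
      by_contra hcz
      obtain ⟨x, b, h, -, -, hxb, hbc, hx, hb, -⟩ := hfirst z hz hzc hcz
      exact hex ⟨x, b, h, hxb, hbc, hx, hb⟩
    intro x hx y hy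
    rw [W.mem_band_zero] at hx hy
    constructor
    · refine fun h => ⟨h.ne, ?_⟩
      by_contra! hne
      exact hac.not_adj_of_common_neighbor h.ne (hadj x hx hne.1).symm (hadj y hy hne.2) h
    · rintro ⟨hxy, rfl | rfl⟩
      · exact hadj y hy hxy.symm
      · exact (hadj x hx hxy).symm
  obtain ⟨y, b, hcy, hyb, hbc, hy, hb⟩ := hex
  have hnb : ∀ x, G.Adj c x → x ≠ y → W.priority y < W.priority x := fun x hx hxy =>
    hsolo y b x hcy hyb hbc hb hx hxy hy
  have huniq : ∀ x b', G.Adj c x → G.Adj x b' → b' ≠ c → W.priority x ≤ k →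
      W.priority b' ≤ k → x = y := by
    intro x b' hcx hxb hb' hx hb'k
    by_contra hxy
    have h1 := hnb x hcx hxy
    have h2 := hsolo x b' y hcx hxb hb' hb'k hcy (Ne.symm hxy) hx
    omega
  -- If `y` had priority `k`, its neighbours `c` and `b` would force two neighbours on `c` as well;
  -- the one other than `y` would have priority above `k`.
  have hyk : W.priority y < k := by
    refine lt_of_le_of_ne hy fun hyk => ?_
    obtain ⟨x, x', hxx, hcx, hcx', hx, hx'⟩ :=
      hchoice y hyk ⟨c, b, hbc.symm, hcy.symm, hyb, hc.le, hb⟩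
    by_cases hxy : x = y
    · have := hnb x' hcx' (fun h => hxx (hxy.trans h.symm)); omega
    · have := hnb x hcx hxy; omega
  have hside : ∀ z, W.priority z ≤ k → z ≠ c → ¬ G.Adj c z →
      ∃ Q : G.Walk y z, Q.IsPath ∧ ∀ w ∈ Q.support, W.priority w ≤ W.priority y := by
    intro z hz hzc hcz
    obtain ⟨x, b', hcx, Q, hQ, hxb, hb', hx, hb'k, hsupp⟩ := hfirst z hz hzc hcz
    obtain rfl := huniq x b' hcx hxb hb' hx hb'k
    have hQ' := (SimpleGraph.Walk.cons_isPath_iff _ _).mp hQ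
    refine ⟨Q, hQ'.1, fun w hw => ?_⟩
    have htake : (SimpleGraph.Walk.cons hcx (Q.takeUntil w hw)).IsPath :=
      (SimpleGraph.Walk.cons_isPath_iff _ _).mpr ⟨hQ'.1.takeUntil hw,
        fun h => hQ'.2 (Q.support_takeUntil_subset_support hw h)⟩
    have hU := hG.min_le_priority htake (w := x) (by simp)
    rwa [hc, min_eq_right (hsupp w hw)] at hU
  have hstarmem : ∀ z ∈ W.band (W.priority y) k, z ≠ c → G.Adj c z := by
    intro z hz hzc
    rw [W.mem_band] at hz
    by_contra hcz
    obtain ⟨Q, -, hQ⟩ := hside z hz.2 hzc hcz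
    have := hQ z (by simp)
    omega
  refine ⟨c, W.priority y, hc, hyk, isStarOn_iff.mpr ⟨W.mem_band.mpr ⟨by omega, hc.le⟩, ?_⟩,
    fun _ => ⟨?_, y, rfl, ?_⟩⟩
  · intro x hx x' hx'
    constructor
    · refine fun h => ⟨h.ne, ?_⟩
      by_contra! hne
      exact hac.not_adj_of_common_neighbor h.ne (hstarmem x hx hne.1).symm
        (hstarmem x' hx' hne.2) h
    · rintro ⟨hxy, rfl | rfl⟩
      · exact hstarmem x' hx' hxy.symm
      · exact (hstarmem x hx hxy).symm
  -- Every player of priority at most `p y` is joined to `y` within that set, so by uniqueness of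
  -- paths the set is path-closed.
  · have hwalk : ∀ z, W.priority z ≤ W.priority y →
        ∃ Q : G.Walk y z, ∀ w ∈ Q.support, W.priority w ≤ W.priority y := by
      intro z hz
      have hzc : z ≠ c := by rintro rfl; omega
      by_cases hcz : G.Adj c z
      · obtain rfl : z = y := by
          by_contra hzy
          have := hnb z hcz hzy
          omega
        exact ⟨.nil, by simp⟩
      · obtain ⟨Q, -, hQ⟩ := hside z (by omega) hzc hcz
        exact ⟨Q, hQ⟩
    intro u hu v hv P hP w hw
    simp only [W.mem_band_zero] at hu hv ⊢
    obtain ⟨Q, hQ⟩ := hwalk u hu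
    obtain ⟨Q', hQ'⟩ := hwalk v hv
    have hmem := hac.support_subset (Q := Q.reverse.append Q') hP hw
    rw [SimpleGraph.Walk.mem_support_append_iff, SimpleGraph.Walk.support_reverse,
      List.mem_reverse] at hmem
    exact hmem.elim (hQ w) (hQ' w)
  · intro z hz w hw
    rw [W.mem_band_zero] at hw
    constructor
    · intro h
      by_cases hzc : z = c
      · subst hzc
        refine ⟨rfl, ?_⟩
        by_contra hwy
        have := hnb w h hwy
        omega
      · have hcz := hstarmem z hz hzc
        rw [W.mem_band] at hz
        obtain rfl := huniq z w hcz h (by rintro rfl; omega) hz.2 (by omega)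
        omega
    · rintro ⟨rfl, rfl⟩
      exact hcy

theorem exists_isStarChain [DecidableRel G.Adj] (hG : IsPriorityDecreasingTree G W)
    (hno : NoDominatedPath G W) {k : ℕ} (h1 : 1 ≤ k) (hk : k ≤ W.numLevels)
    (hL : PathClosed G (W.band 0 k)) :
    ∃ m kk c, kk 1 = k ∧ IsStarChain W G m kk c := by
  induction k using Nat.strong_induction_on with
  | _ k ih =>
  obtain ⟨c, k', hc, hk', hstar, hrest⟩ := exists_star_of_noDominatedPath hG hno h1 hk hL
  by_cases hk0 : k' = 0
  · subst hk0
    refine ⟨1, fun l => if l ≤ 1 then k else 0, fun _ => c, by simp, le_rfl, ?_, by simp, ?_, ?_,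
      fun l h h' => by omega⟩
    · rintro a ⟨ha, -⟩ b ⟨-, hb⟩ hab
      obtain rfl : a = 1 := by omega
      obtain rfl : b = 2 := by omega
      simpa using hk'
    · intro l h h'
      obtain rfl : l = 1 := by omega
      simpa using hstar
    · intro l h h'
      obtain rfl : l = 1 := by omega
      simpa using hc
  · obtain ⟨hL', y, hy, hedge⟩ := hrest (by omega)
    obtain ⟨m, kk, cc, hkk, hch⟩ := ih k' hk' (by omega) (by omega) hL'
    have hm := hch.one_le
    -- The new star takes index `1` and the old chain is shifted by one; the value at index `0` is
    -- irrelevant.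
    refine ⟨m + 1, fun l => if l ≤ 1 then k else kk (l - 1), fun l => if l ≤ 1 then c else cc (l - 1),
      by simp, by omega, ?_, ?_, ?_, ?_, ?_⟩
    · rintro a ⟨ha, ha'⟩ b ⟨hb, hb'⟩ hab
      have hb1 : ¬ b ≤ 1 := by omega
      simp only [hb1, if_false]
      have hle : kk (b - 1) ≤ kk 1 :=
        hch.strictAntiOn.antitoneOn ⟨le_rfl, by omega⟩ ⟨by omega, by omega⟩ (by omega)
      split_ifs with ha1
      · omega
      · exact hch.strictAntiOn ⟨by omega, by omega⟩ ⟨by omega, by omega⟩ (by omega)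
    · have : ¬ m + 1 + 1 ≤ 1 := by omega
      simpa [this] using hch.last
    · intro l h h'
      rcases l with _ | _ | l
      · omega
      · simpa [hkk] using hstar
      · simpa using hch.star (l + 1) (by omega) (by omega)
    · intro l h h'
      rcases l with _ | _ | l
      · omega
      · simpa using hc
      · simpa using hch.priority_center (l + 1) (by omega) (by omega)
    · intro l h h'
      rcases l with _ | _ | l
      · omega
      · have hlt : kk 2 < kk 1 := hch.anti le_rfl hm
        have hcmem := (isStarOn_iff.mp hstar).1
        refine ⟨y, W.mem_band.mpr ⟨?_, ?_⟩, ?_, ?_⟩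
        · simp; omega
        · simp; omega
        · simp; omega
        · ext ⟨z, w⟩
          simp only [Nat.zero_add, le_refl, if_true, Nat.reduceAdd, Nat.reduceLeDiff, if_false,
            Nat.add_one_sub_one, hkk, mem_singleton, Prod.mk.injEq]
          rw [SimpleGraph.interedges, Rel.mk_mem_interedges_iff]
          constructor
          · rintro ⟨hz, hw, h⟩
            exact (hedge z hz w (W.mem_band_zero.mpr (W.mem_band.mp hw).2)).mp h
          · rintro ⟨rfl, rfl⟩
            exact ⟨hcmem, W.mem_band.mpr ⟨by omega, hy.le⟩,
              (hedge z hcmem w (W.mem_band_zero.mpr hy.le)).mpr ⟨rfl, rfl⟩⟩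
      · simpa using hch.edge (l + 1) (by omega) (by omega)

end Unimodal

/-! ### A convex game that excludes dominated paths -/

section Counterexample

variable {N : Type*} [DecidableEq N]

/-- The part of `bonusGame` that only rewards coalitions containing both `a` and `i`. -/
noncomputable def bonus (a i b : N) (δ : ℝ) (S : Finset N) : ℝ :=
  if a ∈ S ∧ i ∈ S then (if b ∈ S then δ else 1) else 0

/-- A large multiple of `|S \ {a}| ^ 2`, plus the worth `1`, reduced to `δ` in the presence of `b`,
that `a` and `i` create together. -/
noncomputable def bonusGame (a i b : N) (δ M : ℝ) : TUGame N where
  value S := M * ((S.erase a).card : ℝ) ^ 2 + bonus a i b δ S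
  value_empty := by simp [bonus]

theorem bonusGame_value (a i b : N) (δ M : ℝ) (S : Finset N) :
    (bonusGame a i b δ M).value S = M * ((S.erase a).card : ℝ) ^ 2 + bonus a i b δ S := rfl

variable {a i b : N} {δ : ℝ}

theorem bonus_nonneg (h0 : 0 ≤ δ) (S : Finset N) : 0 ≤ bonus a i b δ S := by
  unfold bonus
  split_ifs <;> linarith

theorem bonus_le_one (h1 : δ ≤ 1) (S : Finset N) : bonus a i b δ S ≤ 1 := by
  unfold bonus
  split_ifs <;> linarith

theorem bonus_of_notMem_left {S : Finset N} (h : a ∉ S) : bonus a i b δ S = 0 := by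
  simp [bonus, h]

theorem bonus_of_notMem_right {S : Finset N} (h : i ∉ S) : bonus a i b δ S = 0 := by
  simp [bonus, h]

theorem bonus_erase {S : Finset N} {l : N} (hla : l ≠ a) (hli : l ≠ i) (hlb : l ≠ b) :
    bonus a i b δ (S.erase l) = bonus a i b δ S := by
  simp [bonus, hla.symm, hli.symm, hlb.symm]

theorem sq_card_sub_erase_of_ne {S : Finset N} {l : N} (hl : l ∈ S) (hla : l ≠ a) :
    ((S.erase a).card : ℝ) ^ 2 - (((S.erase l).erase a).card : ℝ) ^ 2 =
      2 * ((S.erase a).card : ℝ) - 1 := by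
  have hmem : l ∈ S.erase a := mem_erase.mpr ⟨hla, hl⟩
  rw [erase_right_comm]
  have := card_erase_add_one hmem
  rw [← this]
  push_cast
  ring

variable {W : WeightSystem N}

/-- The weighted marginal contributions to the bonus of a coalition `T` that contains `a`, except
that of `a` itself, add up to a nonnegative number. -/
theorem sum_relWeight_mul_bonus_nonneg {T : Finset N} (hab : a ≠ b) (h0 : 0 ≤ δ)
    (hib : i ≠ b) (hia : i ≠ a) (hpb : W.priority b ≤ W.priority i)
    (hδ : W.priority b = W.priority i → W.weight b ≤ (W.weight i + W.weight b) * δ) :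
    0 ≤ ∑ l ∈ T.erase a, W.relWeight T l * (bonus a i b δ T - bonus a i b δ (T.erase l)) := by
  by_cases hiT : i ∈ T
  swap
  · refine (sum_eq_zero fun l _ => ?_).ge
    rw [bonus_of_notMem_right hiT, bonus_of_notMem_right fun h => hiT (mem_of_mem_erase h)]
    ring
  by_cases hbtop : b ∈ W.top T
  · have hbT := (W.mem_top_iff.mp hbtop).1
    have hpi := (W.mem_top_iff.mp hbtop).2 i hiT
    have hitop : i ∈ W.top T := W.mem_top_iff.mpr
      ⟨hiT, fun j hj => ((W.mem_top_iff.mp hbtop).2 j hj).trans hpb⟩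
    have hsub : ({i, b} : Finset N) ⊆ T.erase a := by
      intro x hx
      simp only [mem_insert, mem_singleton] at hx
      rcases hx with rfl | rfl
      · exact mem_erase.mpr ⟨hia, hiT⟩
      · exact mem_erase.mpr ⟨hab.symm, hbT⟩
    -- Only `i` and `b` affect the bonus. If `a ∈ T`, the sum is `w_i δ + w_b (δ - 1)`, nonnegative
    -- by `hδ`.
    rw [← sum_subset hsub, sum_pair hib, W.relWeight_of_mem_top hitop,
      W.relWeight_of_mem_top hbtop, bonus_of_notMem_right (notMem_erase i T), bonus, bonus]
    · have hw := hδ (le_antisymm hpb hpi)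
      by_cases haT : a ∈ T
      · simp only [haT, hiT, hbT, hib, hab, mem_erase, ne_eq, not_true_eq_false, not_false_eq_true,
          and_self, if_true, false_and, if_false, sub_zero]
        linarith
      · simp [haT]
    · intro l hl hl'
      simp only [mem_insert, mem_singleton, not_or] at hl'
      rw [bonus_erase (mem_erase.mp hl).1 hl'.1 hl'.2]
      ring
  · refine sum_nonneg fun l hl => ?_
    by_cases hlb : l = b
    · rw [hlb, W.relWeight_of_notMem_top hbtop, zero_mul]
    · refine mul_nonneg (W.relWeight_nonneg T l) ?_
      by_cases hli : l = i
      · rw [hli, bonus_of_notMem_right (notMem_erase i T), sub_zero]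
        exact bonus_nonneg h0 T
      · rw [bonus_erase (mem_erase.mp hl).1 hli hlb, sub_self]

/-- The quadratic term ignores `a`. If a top player of `T` other than `a` lies in `S` and `S`, `T`
differ beyond `a`, it outweighs all bonus changes; if they differ only in `a`, the bonus alone
decides. -/
theorem isConvexGame_bonusGame [Fintype N] (hab : a ≠ b) (hib : i ≠ b) (hia : i ≠ a)
    (h0 : 0 ≤ δ) (h1 : δ ≤ 1) (hpa : W.priority a ≤ W.priority i)
    (hpb : W.priority b ≤ W.priority i)
    (hδ : W.priority b = W.priority i → W.weight b ≤ (W.weight i + W.weight b) * δ)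
    {M : ℝ} (hM : ∀ l, ∑ x, W.weight x ≤ M * W.weight l) :
    W.IsConvexGame (bonusGame a i b δ M) := by
  intro S T hST
  have hM0 : 0 ≤ M := by
    have h := (sum_nonneg fun x _ => (W.weight_pos x).le).trans (hM i)
    exact nonneg_of_mul_nonneg_left h (W.weight_pos i)
  have hgr : ∀ R : Finset N, 0 ≤ bonus a i b δ R ∧ bonus a i b δ R ≤ 1 :=
    fun R => ⟨bonus_nonneg h0 R, bonus_le_one h1 R⟩
  have hterm_a : ∀ l ∈ S, l = a → (bonusGame a i b δ M).value T
      - (bonusGame a i b δ M).value (T.erase l) - (bonusGame a i b δ M).value S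
      + (bonusGame a i b δ M).value (S.erase l) = bonus a i b δ T - bonus a i b δ S := by
    rintro l - rfl
    simp only [bonusGame_value, erase_idem]
    rw [bonus_of_notMem_left (notMem_erase l T), bonus_of_notMem_left (notMem_erase l S)]
    ring
  have hterm : ∀ l ∈ S, l ≠ a → (bonusGame a i b δ M).value T
      - (bonusGame a i b δ M).value (T.erase l) - (bonusGame a i b δ M).value S
      + (bonusGame a i b δ M).value (S.erase l) =
      2 * M * (((T.erase a).card : ℝ) - (S.erase a).card) + (bonus a i b δ T
        - bonus a i b δ (T.erase l) - bonus a i b δ S + bonus a i b δ (S.erase l)) := by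
    intro l hl hla
    have e1 := sq_card_sub_erase_of_ne (hST hl) hla
    have e2 := sq_card_sub_erase_of_ne hl hla
    simp only [bonusGame_value]
    linear_combination M * e1 - M * e2
  by_cases hex : ∃ l ∈ S, l ≠ a ∧ l ∈ W.top T
  swap
  · refine sum_nonneg fun l hl => ?_
    by_cases hlT : l ∈ W.top T
    swap
    · rw [W.relWeight_of_notMem_top hlT, zero_mul]
    obtain rfl : l = a := by
      by_contra hla
      exact hex ⟨l, hl, hla, hlT⟩
    rw [hterm_a l hl rfl]
    refine mul_nonneg (W.relWeight_nonneg T l) ?_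
    have hiS : i ∉ S := fun hiS => hex ⟨i, hiS, hia, W.mem_top_iff.mpr
      ⟨hST hiS, fun j hj => ((W.mem_top_iff.mp hlT).2 j hj).trans hpa⟩⟩
    rw [bonus_of_notMem_right hiS, sub_zero]
    exact bonus_nonneg h0 T
  obtain ⟨l, hlS, hla, hlT⟩ := hex
  by_cases hcard : T.erase a = S.erase a
  · by_cases haS : a ∈ S
    · have : S = T := by rw [← insert_erase haS, ← insert_erase (hST haS), hcard]
      subst this
      simp
    · have hSe : S = T.erase a := by rw [hcard, erase_eq_of_notMem haS]
      have := sum_relWeight_mul_bonus_nonneg (W := W) (T := T) hab h0 hib hia hpb hδ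
      rw [← hSe] at this
      refine this.trans_eq (sum_congr rfl fun x hx => ?_)
      have hxa : x ≠ a := fun h => haS (h ▸ hx)
      rw [hterm x hx hxa, hcard, bonus_of_notMem_left haS,
        bonus_of_notMem_left fun h => haS (mem_of_mem_erase h)]
      ring
  · have hlt : ((S.erase a).card : ℝ) + 1 ≤ (T.erase a).card := by
      have := card_lt_card ((erase_subset_erase a hST).ssubset_of_ne (Ne.symm hcard))
      exact_mod_cast this
    -- The quadratic gain is kept only at `l`; elsewhere it is dropped as nonnegative. The bonuses
    -- lie in `[0, 1]`, so their alternating sum is at least `-2`.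
    have hbound : ∀ x ∈ S, W.relWeight T x * (if x = l then 2 * M else 0) - 2 * W.weight x ≤
        W.relWeight T x * ((bonusGame a i b δ M).value T
          - (bonusGame a i b δ M).value (T.erase x) - (bonusGame a i b δ M).value S
          + (bonusGame a i b δ M).value (S.erase x)) := by
      intro x hx
      have hle : (if x = l then 2 * M else 0) - 2 ≤ (bonusGame a i b δ M).value T
          - (bonusGame a i b δ M).value (T.erase x) - (bonusGame a i b δ M).value S
          + (bonusGame a i b δ M).value (S.erase x) := by
        have b1 := hgr T
        have b2 := hgr S
        by_cases hxa : x = a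
        · rw [hterm_a x hx hxa, if_neg fun h => hla (h.symm.trans hxa)]
          linarith
        · rw [hterm x hx hxa]
          have b3 := hgr (T.erase x)
          have b4 := hgr (S.erase x)
          have : 2 * M * 1 ≤ 2 * M * (((T.erase a).card : ℝ) - (S.erase a).card) :=
            mul_le_mul_of_nonneg_left (by linarith) (by linarith)
          split_ifs <;> linarith
      have hw : W.relWeight T x ≤ W.weight x := by
        unfold WeightSystem.relWeight
        split_ifs
        exacts [le_rfl, (W.weight_pos x).le]
      have := mul_le_mul_of_nonneg_left hle (W.relWeight_nonneg T x)
      linarith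
    refine le_trans ?_ (sum_le_sum hbound)
    rw [sum_sub_distrib, ← mul_sum]
    simp only [mul_ite, mul_zero, sum_ite_eq' S l, hlS, if_true]
    rw [W.relWeight_of_mem_top hlT]
    have hs : ∑ x ∈ S, W.weight x ≤ ∑ x, W.weight x :=
      sum_le_sum_of_subset_of_nonneg (subset_univ S) fun x _ _ => (W.weight_pos x).le
    have := hM l
    linarith

variable {G : SimpleGraph N}

theorem noDominatedPath_of_preservesConvexity [Fintype N] (hG : G.IsAcyclic)
    (hpres : PreservesConvexity G W) : NoDominatedPath G W := by
  intro a i j b hai hij hjb haj hib hpij hpa hpb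
  have nij := hij.ne
  have nai := hai.ne
  have njb := hjb.ne
  have naj : ¬ G.Adj a j := hG.not_adj_of_common_neighbor haj hai hij
  have nib : ¬ G.Adj i b := hG.not_adj_of_common_neighbor hib hij hjb
  have hab : a ≠ b := by rintro rfl; exact naj hjb.symm
  have nab : ¬ G.Adj a b := hG.not_adj_of_path_three hai hij hjb haj hib hab
  have hwi := W.weight_pos i
  have hwj := W.weight_pos j
  have hwb := W.weight_pos b
  -- For equal priorities `δ` balances the contributions `w_i δ` and `w_b (δ - 1)` exactly, leaving
  -- the strictly negative term `w_j (δ - 1)` of `j` in the communication game.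
  obtain ⟨δ, h0, h1, hδ, hδ'⟩ : ∃ δ : ℝ, 0 ≤ δ ∧ δ < 1 ∧
      (W.priority b = W.priority i → (W.weight i + W.weight b) * δ = W.weight b) ∧
      (W.priority b ≠ W.priority i → δ = 0) := by
    by_cases h : W.priority b = W.priority i
    · refine ⟨W.weight b / (W.weight i + W.weight b), by positivity, ?_, fun _ => ?_,
        fun h' => absurd h h'⟩
      · rw [div_lt_one (by linarith)]; linarith
      · field_simp
    · exact ⟨0, le_rfl, one_pos, fun h' => absurd h' h, fun _ => rfl⟩
  set M : ℝ := ∑ l, (∑ x, W.weight x) / W.weight l with hMdef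
  have hM : ∀ l, ∑ x, W.weight x ≤ M * W.weight l := by
    intro l
    rw [← div_le_iff₀ (W.weight_pos l)]
    exact single_le_sum (f := fun l => (∑ x, W.weight x) / W.weight l)
      (fun x _ => div_nonneg (sum_nonneg fun x _ => (W.weight_pos x).le) (W.weight_pos x).le)
      (mem_univ l)
  set v := bonusGame a i b δ M with hv
  -- The two coalitions differ only by `a`, so all multiples of `M` cancel.
  have hconv := hpres v (isConvexGame_bonusGame hab hib nai.symm h0 h1.le hpa hpb
    (fun h => (hδ h).ge) hM) {i, j, b} {a, i, j, b} (subset_insert _ _)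
  have cij : ConnectedOn G {i, j} := connectedOn_singleton.insert (mem_singleton_self j) hij
  have cjb : ConnectedOn G {j, b} := connectedOn_singleton.insert (mem_singleton_self b) hjb
  have cai : ConnectedOn G {a, i} := connectedOn_singleton.insert (mem_singleton_self i) hai
  have cijb : ConnectedOn G {i, j, b} := cjb.insert (mem_insert_self _ _) hij
  have caij : ConnectedOn G {a, i, j} := cij.insert (mem_insert_self _ _) hai
  have caijb : ConnectedOn G {a, i, j, b} := cijb.insert (mem_insert_self _ _) hai
  have vT : (communicationGame G v).value {a, i, j, b} = 9 * M + δ := by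
    rw [communicationGame_of_connectedOn v caijb, hv, bonusGame_value]
    have : ({a, i, j, b} : Finset N).erase a = {i, j, b} := by grind
    rw [this, card_eq_three.mpr ⟨i, j, b, nij, hib, njb, rfl⟩]
    simp [bonus]; ring
  have vS : (communicationGame G v).value {i, j, b} = 9 * M := by
    rw [communicationGame_of_connectedOn v cijb, hv, bonusGame_value]
    have : ({i, j, b} : Finset N).erase a = {i, j, b} := by grind
    rw [this, card_eq_three.mpr ⟨i, j, b, nij, hib, njb, rfl⟩]
    simp [bonus, nai, haj, hab]; ring
  have vjb : v.value {j, b} = 4 * M := by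
    rw [hv, bonusGame_value]
    have : ({j, b} : Finset N).erase a = {j, b} := by grind
    rw [this, card_pair njb]
    simp [bonus, haj, hab]; ring
  have vij : v.value {i, j} = 4 * M := by
    rw [hv, bonusGame_value]
    have : ({i, j} : Finset N).erase a = {i, j} := by grind
    rw [this, card_pair nij]
    simp [bonus, nai, haj]; ring
  have vaij : v.value {a, i, j} = 4 * M + 1 := by
    rw [hv, bonusGame_value]
    have : ({a, i, j} : Finset N).erase a = {i, j} := by grind
    rw [this, card_pair nij]
    simp [bonus, hab.symm, hib.symm, njb.symm]; ring
  have vai : v.value {a, i} = M + 1 := by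
    rw [hv, bonusGame_value]
    have : ({a, i} : Finset N).erase a = {i} := by grind
    rw [this, card_singleton]
    simp [bonus, hab.symm, hib.symm]
  have va : v.value {a} = 0 := by
    rw [hv, bonusGame_value]
    simp [bonus, nai.symm]
  have vi : v.value {i} = M := by
    rw [hv, bonusGame_value]
    have : ({i} : Finset N).erase a = {i} := by grind
    rw [this, card_singleton]
    simp [bonus, nai]
  have vb : v.value {b} = M := by
    rw [hv, bonusGame_value]
    have : ({b} : Finset N).erase a = {b} := by grind
    rw [this, card_singleton]
    simp [bonus, hab]
  have vTi : (communicationGame G v).value (({a, i, j, b} : Finset N).erase i) = 4 * M := by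
    have : ({a, i, j, b} : Finset N).erase i = {a} ∪ {j, b} := by grind
    rw [this, communicationGame_union, communicationGame_of_connectedOn v connectedOn_singleton,
      communicationGame_of_connectedOn v cjb, va, vjb, zero_add]
    · simp [haj, hab]
    · simp [naj, nab]
  have vSi : (communicationGame G v).value (({i, j, b} : Finset N).erase i) = 4 * M := by
    have : ({i, j, b} : Finset N).erase i = {j, b} := by grind
    rw [this, communicationGame_of_connectedOn v cjb, vjb]
  have vTj : (communicationGame G v).value (({a, i, j, b} : Finset N).erase j) = 2 * M + 1 := by
    have : ({a, i, j, b} : Finset N).erase j = {a, i} ∪ {b} := by grind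
    rw [this, communicationGame_union, communicationGame_of_connectedOn v connectedOn_singleton,
      communicationGame_of_connectedOn v cai, vai, vb]
    · ring
    · simp [hab.symm, hib.symm]
    · simp [nab, nib]
  have vSj : (communicationGame G v).value (({i, j, b} : Finset N).erase j) = 2 * M := by
    have : ({i, j, b} : Finset N).erase j = {i} ∪ {b} := by grind
    rw [this, communicationGame_union, communicationGame_of_connectedOn v connectedOn_singleton,
      communicationGame_of_connectedOn v connectedOn_singleton, vi, vb]
    · ring
    · simp [hib]
    · simp [nib]
  have vTb : (communicationGame G v).value (({a, i, j, b} : Finset N).erase b) = 4 * M + 1 := by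
    have : ({a, i, j, b} : Finset N).erase b = {a, i, j} := by grind
    rw [this, communicationGame_of_connectedOn v caij, vaij]
  have vSb : (communicationGame G v).value (({i, j, b} : Finset N).erase b) = 4 * M := by
    have : ({i, j, b} : Finset N).erase b = {i, j} := by grind
    rw [this, communicationGame_of_connectedOn v cij, vij]
  have htop : ∀ x ∈ ({a, i, j, b} : Finset N), W.priority x ≤ W.priority j := by
    intro x hx
    simp only [mem_insert, mem_singleton] at hx
    rcases hx with rfl | rfl | rfl | rfl <;> omega
  have hj : W.relWeight {a, i, j, b} j = W.weight j :=
    W.relWeight_of_mem_top (W.mem_top_iff.mpr ⟨by simp, htop⟩)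
  rw [sum_insert (by simp [nij, hib]), sum_pair njb, vT, vS, vTi, vSi, vTj, vSj, vTb, vSb,
    hj] at hconv
  have hlt : W.weight j * (δ - 1) < 0 := mul_neg_of_pos_of_neg hwj (by linarith)
  have hrest : W.relWeight {a, i, j, b} i * δ + W.relWeight {a, i, j, b} b * (δ - 1) ≤ 0 := by
    by_cases hpbi : W.priority b = W.priority i
    · have hrel : (b ∈ W.top {a, i, j, b}) ↔ i ∈ W.top {a, i, j, b} := by
        simp only [W.mem_top_iff, hpbi]
        simp
      by_cases hitop : i ∈ W.top {a, i, j, b}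
      · rw [W.relWeight_of_mem_top hitop, W.relWeight_of_mem_top (hrel.mpr hitop)]
        linarith [hδ hpbi]
      · rw [W.relWeight_of_notMem_top hitop, W.relWeight_of_notMem_top (hitop ∘ hrel.mp)]
        simp
    · rw [hδ' hpbi]
      linarith [W.relWeight_nonneg {a, i, j, b} b]
  linarith

end Counterexample

theorem mainTheorem2 {N : Type*} [Fintype N] [DecidableEq N]
    (W : WeightSystem N) (G : SimpleGraph N) [DecidableRel G.Adj]
    (hG : IsPriorityDecreasingTree G W) :
    PreservesConvexity G W ↔
      ∃ (m : ℕ) (k : ℕ → ℕ) (c : ℕ → N), 1 ≤ m ∧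
        StrictAntiOn k (Set.Icc 1 (m + 1)) ∧ k 1 = W.numLevels ∧ k (m + 1) = 0 ∧
        (∀ l, 1 ≤ l → l ≤ m → IsStarOn G (W.band (k (l + 1)) (k l)) (c l)) ∧
        (∀ l, 1 ≤ l → l ≤ m → W.priority (c l) = k l) ∧
        (∀ l, 1 ≤ l → l + 1 ≤ m →
          ∃ y ∈ W.band (k (l + 2)) (k (l + 1)), W.priority y = k (l + 1) ∧
            G.interedges (W.band (k (l + 1)) (k l)) (W.band (k (l + 2)) (k (l + 1)))
              = {(c l, y)}) := by
  constructor
  · intro hpres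
    have hlevels : 1 ≤ W.numLevels := by
      obtain ⟨x⟩ := hG.1.connected.nonempty
      exact (W.priority_mem x).1.trans (W.priority_mem x).2
    obtain ⟨m, k, c, hk, h⟩ := exists_isStarChain hG
      (noDominatedPath_of_preservesConvexity hG.1.isAcyclic hpres) hlevels le_rfl
      fun _ _ _ _ _ _ w _ => W.mem_band_zero.mpr (W.priority_mem w).2
    exact ⟨m, k, c, h.one_le, h.strictAntiOn, hk, h.last, h.star, h.priority_center, h.edge⟩
  · rintro ⟨m, k, c, h1, hanti, hk, hlast, hstar, hpc, hedge⟩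
    exact IsStarChain.preservesConvexity ⟨h1, hanti, hlast, hstar, hpc, hedge⟩ hG.1 hk
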